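/- Let $\mathcal H$ be a complex Hilbert space, $\hbar>0$, and let $\hat H$ be a (possibly unbounded) self-adjoint operator on $\mathcal H$, the time-independent Hamiltonian of a closed quantum system. Let $\hat U(t)=e^{-\frac{i}{\hbar}t\hat H}$, $t\in\mathbb R$, be its time evolution, i.e. the family of bounded operators with $\hat U(0)=1$ such that for every $\psi_0$ in the domain of $\hat H$ the curve $\psi(t)=\hat U(t)\psi_0$ stays in that domain and solves the Schrödinger equation $i\hbar\,\frac{d}{dt}\psi(t)=\hat H\psi(t)$ on $\mathbb R$. Let $|s_1\rangle,|s_2\rangle\in\mathcal H$ be unit vectors and $t_1<t_2$ real numbers such that: (1) the system can evolve from $|s_1\rangle$ at time $t_1$ to $|s_2\rangle$ at time $t_2$, possibly suffering a projection: $\langle s_2|\hat U(t_2-t_1)|s_1\rangle\neq 0$; (2) $|s_1\rangle$ and $|s_2\rangle$ are perfectly distinguishable: $\langle s_1|s_2\rangle=0$; (3) the probability that the system, being in the state $|s_2\rangle$ at time $t_2$, returns to $|s_1\rangle$ at a later time is zero: $|\langle s_1|\hat U(t-t_2)|s_2\rangle|^2=0$ for all $t>t_2$. Then the system cannot have a ground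 state: $\hat H$ is not bounded below, i.e. there is no $E\in\mathbb R$ with $\langle\psi|\hat H|\psi\rangle\ge E\,\langle\psi|\psi\rangle$ for all $\psi$ in the domain of $\hat H$; in particular, $\hat H$ has no eigenvector whose eigenvalue is such a lower bound $E$. -/

import Mathlib

open scoped InnerProductSpace

/-- `U` is the propagator of the Schrödinger equation `iħ dψ/dt = Hψ`: a family of bounded operators
with `U 0 = 1` such that, for every initial vector `ψ₀` in the domain of `H`, the curve
`t ↦ U t ψ₀` stays in the domain of `H` and has the derivative `-(i/ħ) H (U t ψ₀)` at every time.
When `H` is self-adjoint, there is exactly one such family, the strongly continuous one-parameter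
unitary group `exp (-(i/ħ) t H)`. -/
structure IsPropagator {𝓗 : Type*} [NormedAddCommGroup 𝓗] [InnerProductSpace ℂ 𝓗]
    (ħ : ℝ) (H : 𝓗 →ₗ.[ℂ] 𝓗) (U : ℝ → 𝓗 →L[ℂ] 𝓗) : Prop where
  map_zero : U 0 = 1
  schrodinger : ∀ ψ₀ ∈ H.domain, ∀ t : ℝ, ∃ h : U t ψ₀ ∈ H.domain,
    HasDerivAt (fun s : ℝ => U s ψ₀) (-(Complex.I / (ħ : ℂ)) • H ⟨U t ψ₀, h⟩) t

/-- The propagator of a self-adjoint Hamiltonian is unique. -/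
theorem IsPropagator.unique {𝓗 : Type*} [NormedAddCommGroup 𝓗] [InnerProductSpace ℂ 𝓗]
    [CompleteSpace 𝓗] {ħ : ℝ} {H : 𝓗 →ₗ.[ℂ] 𝓗} (hH : IsSelfAdjoint H)
    {U V : ℝ → 𝓗 →L[ℂ] 𝓗} (hU : IsPropagator ħ H U) (hV : IsPropagator ħ H V) : U = V := by
  have hdense : Dense (H.domain : Set 𝓗) := hH.dense_domain
  have hsymm : ∀ x y : H.domain, ⟪H x, (y : 𝓗)⟫_ℂ = ⟪(x : 𝓗), H y⟫_ℂ := by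
    have h := LinearPMap.adjoint_isFormalAdjoint hdense
    rw [LinearPMap.isSelfAdjoint_def.mp hH] at h
    exact h
  funext t
  refine ContinuousLinearMap.ext fun ψ => ?_
  refine congrFun (Continuous.ext_on hdense (U t).continuous (V t).continuous ?_) ψ
  intro ψ₀ hψ₀
  have key : ∀ s : ℝ, HasDerivAt
      (fun s : ℝ => ⟪U s ψ₀ - V s ψ₀, U s ψ₀ - V s ψ₀⟫_ℂ) 0 s := by
    intro s
    obtain ⟨hu, du⟩ := hU.schrodinger ψ₀ hψ₀ s
    obtain ⟨hv, dv⟩ := hV.schrodinger ψ₀ hψ₀ s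
    have hd := du.sub dv
    rw [← smul_sub, ← LinearPMap.map_sub] at hd
    have h2 := hd.inner ℂ hd
    have hs := hsymm (⟨U s ψ₀, hu⟩ - ⟨V s ψ₀, hv⟩) (⟨U s ψ₀, hu⟩ - ⟨V s ψ₀, hv⟩)
    simp only [Submodule.coe_sub] at hs
    refine h2.congr_deriv ?_
    simp only [Pi.sub_apply, inner_smul_left, inner_smul_right, hs]
    simp [inner_sub_left]
    ring
  have hconst := is_const_of_deriv_eq_zero (fun s => (key s).differentiableAt)
    (fun s => (key s).deriv) t 0
  simp only [hU.map_zero, hV.map_zero, sub_self, inner_zero_left] at hconst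
  exact sub_eq_zero.mp (inner_self_eq_zero.mp hconst)

open Classical in
/-- The time evolution operator `U(t) = exp (-(i/ħ) t H)` of a self-adjoint Hamiltonian `H`,
defined as the propagator of the Schrödinger equation with Hamiltonian `H`. -/
noncomputable def timeEvolution {𝓗 : Type*} [NormedAddCommGroup 𝓗] [InnerProductSpace ℂ 𝓗]
    (ħ : ℝ) (H : 𝓗 →ₗ.[ℂ] 𝓗) : ℝ → 𝓗 →L[ℂ] 𝓗 :=
  if h : ∃ U : ℝ → 𝓗 →L[ℂ] 𝓗, IsPropagator ħ H U then h.choose else 0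

/-- For a self-adjoint Hamiltonian, `timeEvolution ħ H` is the propagator. -/
theorem IsPropagator.timeEvolution_eq {𝓗 : Type*} [NormedAddCommGroup 𝓗] [InnerProductSpace ℂ 𝓗]
    [CompleteSpace 𝓗] {ħ : ℝ} {H : 𝓗 →ₗ.[ℂ] 𝓗} (hH : IsSelfAdjoint H)
    {U : ℝ → 𝓗 →L[ℂ] 𝓗} (hU : IsPropagator ħ H U) : timeEvolution ħ H = U := by
  have h : ∃ U : ℝ → 𝓗 →L[ℂ] 𝓗, IsPropagator ħ H U := ⟨U, hU⟩
  rw [timeEvolution, dif_pos h]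
  exact IsPropagator.unique hH h.choose_spec hU

/-- `E` is a lower bound of the energy: `⟨ψ|H|ψ⟩ ≥ E ⟨ψ|ψ⟩` for all `ψ` in the domain of `H`. -/
def IsEnergyLowerBound {𝓗 : Type*} [NormedAddCommGroup 𝓗] [InnerProductSpace ℂ 𝓗]
    (H : 𝓗 →ₗ.[ℂ] 𝓗) (E : ℝ) : Prop :=
  ∀ ψ : H.domain, E * ‖(ψ : 𝓗)‖ ^ 2 ≤ (⟪(ψ : 𝓗), H ψ⟫_ℂ).re

/-- The Hamiltonian is bounded below. -/
def IsBoundedBelow {𝓗 : Type*} [NormedAddCommGroup 𝓗] [InnerProductSpace ℂ 𝓗]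
    (H : 𝓗 →ₗ.[ℂ] 𝓗) : Prop :=
  ∃ E : ℝ, IsEnergyLowerBound H E

/-- The Hamiltonian has a ground state vector: an eigenvector whose energy is the minimum. -/
def HasGroundState {𝓗 : Type*} [NormedAddCommGroup 𝓗] [InnerProductSpace ℂ 𝓗]
    (H : 𝓗 →ₗ.[ℂ] 𝓗) : Prop :=
  ∃ (E : ℝ) (Ω : H.domain), (Ω : 𝓗) ≠ 0 ∧ H Ω = (E : ℂ) • (Ω : 𝓗) ∧ IsEnergyLowerBound H E

/-! Suppose `H ≥ E` and let f(t) = ⟨s₁, U(t) s₂⟩. Up to a constant factor, the matrix element ⟨s₁,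
(H - z)⁻¹ s₂⟩ is the Laplace transform of f over t ≥ 0 when Im z > 0, and over t ≤ 0 when Im z < 0.
No return means f = 0 on t ≥ 0, so the element vanishes on the upper half-plane
(`IsPropagator.inner_resolvent_eq_zero_of_forward`). It is holomorphic off [E, ∞), and the gap below
`E` joins the two half-planes, so it vanishes on the lower one too
(`IsEnergyLowerBound.inner_resolvent_eq_zero`). Injectivity of the Laplace transform then gives f =
0 on t ≤ 0 (`IsPropagator.inner_apply_eq_zero_of_resolvent`). But f(t₁ - t₂) is the conjugate of the
nonzero amplitude. The spectral theorem is avoided: the resolvent comes from norm estimates, and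
unitarity from conservation of inner products. -/

/-! ### Resolvent of a self-adjoint operator bounded below -/

section Resolvent

variable {𝓗 : Type*} [NormedAddCommGroup 𝓗] [InnerProductSpace ℂ 𝓗]

/-- The operator `H - z`, as a linear map on the domain of `H`. -/
noncomputable def LinearPMap.subScalar (H : 𝓗 →ₗ.[ℂ] 𝓗) (z : ℂ) : H.domain →ₗ[ℂ] 𝓗 :=
  H.toFun - z • H.domain.subtype

theorem LinearPMap.subScalar_apply (H : 𝓗 →ₗ.[ℂ] 𝓗) (z : ℂ) (x : H.domain) :
    H.subScalar z x = H x - z • (x : 𝓗) := rfl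

theorem IsSelfAdjoint.inner_map_left [CompleteSpace 𝓗] {H : 𝓗 →ₗ.[ℂ] 𝓗} (hH : IsSelfAdjoint H)
    (x y : H.domain) : ⟪H x, (y : 𝓗)⟫_ℂ = ⟪(x : 𝓗), H y⟫_ℂ := by
  have h := LinearPMap.adjoint_isFormalAdjoint hH.dense_domain
  rw [LinearPMap.isSelfAdjoint_def.mp hH] at h
  exact h x y

theorem IsSelfAdjoint.mem_domain_of_inner [CompleteSpace 𝓗] {H : 𝓗 →ₗ.[ℂ] 𝓗}
    (hH : IsSelfAdjoint H) {y w : 𝓗} (h : ∀ x : H.domain, ⟪w, (x : 𝓗)⟫_ℂ = ⟪y, H x⟫_ℂ) :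
    ∃ hy : y ∈ H.domain, H ⟨y, hy⟩ = w := by
  have hA : y ∈ H.adjoint.domain := LinearPMap.mem_adjoint_domain_of_exists y ⟨w, h⟩
  have hB := LinearPMap.adjoint_apply_eq hH.dense_domain ⟨y, hA⟩ h
  have hHa : H.adjoint = H := LinearPMap.isSelfAdjoint_def.mp hH
  revert hA
  rw [hHa]
  exact fun hA hB => ⟨hA, hB⟩

theorem IsSelfAdjoint.linearPMap_isClosed [CompleteSpace 𝓗] {H : 𝓗 →ₗ.[ℂ] 𝓗}
    (hH : IsSelfAdjoint H) : H.IsClosed := by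
  have h := LinearPMap.adjoint_isClosed hH.dense_domain
  rwa [LinearPMap.isSelfAdjoint_def.mp hH] at h

/-- A closed operator `H - z` that is bounded below has closed range. -/
theorem LinearPMap.isClosed_range_subScalar [CompleteSpace 𝓗] {H : 𝓗 →ₗ.[ℂ] 𝓗}
    (hH : H.IsClosed) {z : ℂ} {c : ℝ} (hc : 0 < c)
    (hb : ∀ x : H.domain, c * ‖(x : 𝓗)‖ ≤ ‖H.subScalar z x‖) :
    _root_.IsClosed (LinearMap.range (H.subScalar z) : Set 𝓗) := by
  have hcl : _root_.IsClosed (H.graph : Set (𝓗 × 𝓗)) := hH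
  have : CompleteSpace H.graph := hcl.completeSpace_coe
  -- On the complete graph of `H`, `H - z` becomes a bounded operator, antilipschitz for the graph
  -- norm.
  let G : H.graph →L[ℂ] 𝓗 :=
    ((ContinuousLinearMap.snd ℂ 𝓗 𝓗) - z • (ContinuousLinearMap.fst ℂ 𝓗 𝓗)).comp H.graph.subtypeL
  have hG : ∀ p : H.graph, G p = p.1.2 - z • p.1.1 := fun p => rfl
  have hK : (0 : ℝ) ≤ 1 / c + (1 + ‖z‖ / c) := by positivity
  have hanti : AntilipschitzWith ⟨_, hK⟩ G := by
    refine G.antilipschitz_of_bound fun p => ?_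
    obtain ⟨x, hx1, hx2⟩ := (LinearPMap.mem_graph_iff H).1 p.2
    have hGx : G p = H.subScalar z x := by
      rw [hG, LinearPMap.subScalar_apply, hx1, hx2]
    have h1 : ‖p.1.1‖ ≤ 1 / c * ‖G p‖ := by
      rw [hGx, ← hx1, div_mul_eq_mul_div, one_mul, le_div_iff₀ hc, mul_comm]
      exact hb x
    have h2 : ‖p.1.2‖ ≤ (1 + ‖z‖ / c) * ‖G p‖ := by
      have h3 : p.1.2 = G p + z • p.1.1 := by rw [hG]; abel
      calc ‖p.1.2‖ ≤ ‖G p‖ + ‖z‖ * ‖p.1.1‖ := by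
            conv_lhs => rw [h3]
            exact (norm_add_le _ _).trans (by rw [norm_smul])
        _ ≤ ‖G p‖ + ‖z‖ * (1 / c * ‖G p‖) := by gcongr
        _ = _ := by ring
    change ‖p.1‖ ≤ (1 / c + (1 + ‖z‖ / c)) * ‖G p‖
    have hn := norm_nonneg (G p)
    rw [Prod.norm_def, add_mul]
    exact max_le (h1.trans (le_add_of_nonneg_right (by positivity)))
      (h2.trans (le_add_of_nonneg_left (by positivity)))
  have hr : (LinearMap.range (H.subScalar z) : Set 𝓗) = Set.range G := by
    ext y
    constructor
    · rintro ⟨x, rfl⟩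
      exact ⟨⟨(x, H x), H.mem_graph x⟩, rfl⟩
    · rintro ⟨p, rfl⟩
      obtain ⟨x, hx1, hx2⟩ := (LinearPMap.mem_graph_iff H).1 p.2
      exact ⟨x, by rw [hG, LinearPMap.subScalar_apply, hx1, hx2]⟩
  rw [hr]
  exact hanti.isClosed_range G.uniformContinuous

open ComplexConjugate in
/-- A self-adjoint `H` for which `H - z` and its adjoint are bounded below has `z` in its
resolvent set. -/
theorem IsSelfAdjoint.surjective_subScalar [CompleteSpace 𝓗] {H : 𝓗 →ₗ.[ℂ] 𝓗}
    (hH : IsSelfAdjoint H) {z : ℂ} {c : ℝ} (hc : 0 < c)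
    (hb : ∀ x : H.domain, c * ‖(x : 𝓗)‖ ≤ ‖H.subScalar z x‖)
    (hb' : ∀ x : H.domain, c * ‖(x : 𝓗)‖ ≤ ‖H.subScalar (conj z) x‖) :
    Function.Surjective (H.subScalar z) := by
  have hcl := LinearPMap.isClosed_range_subScalar hH.linearPMap_isClosed hc hb
  -- The range is closed, so a trivial orthogonal complement suffices; a vector `y` in it satisfies
  -- `H y = conj z • y`, which `hb'` excludes unless `y = 0`.
  rw [← LinearMap.range_eq_top, ← hcl.submodule_topologicalClosure_eq,
    Submodule.topologicalClosure_eq_top_iff, Submodule.eq_bot_iff]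
  intro y hy
  rw [Submodule.mem_orthogonal'] at hy
  obtain ⟨hyd, hHy⟩ := hH.mem_domain_of_inner (y := y) (w := conj z • y) fun x => by
    have h := hy _ ⟨x, rfl⟩
    rw [LinearPMap.subScalar_apply, inner_sub_right, inner_smul_right, sub_eq_zero] at h
    rw [inner_smul_left, h, Complex.conj_conj]
  have h := hb' ⟨y, hyd⟩
  rw [LinearPMap.subScalar_apply, hHy, sub_self, norm_zero] at h
  exact norm_le_zero_iff.1 (nonpos_of_mul_nonpos_right h hc)

/-- A lower bound of the distance of `z` from the half-line `[E, ∞)`, positive off that half-line. -/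
noncomputable def halfLineGap (E : ℝ) (z : ℂ) : ℝ := max (E - z.re) |z.im|

theorem continuous_halfLineGap (E : ℝ) : Continuous (halfLineGap E) := by
  unfold halfLineGap; fun_prop

theorem halfLineGap_pos_iff {E : ℝ} {z : ℂ} :
    0 < halfLineGap E z ↔ (E : ℂ) - z ∈ Complex.slitPlane := by
  simp [halfLineGap, Complex.mem_slitPlane_iff]

/-- Since ⟨x, H x⟩ is real, Cauchy–Schwarz applied to the real and imaginary parts of ⟨x, (H - z) x⟩
yields the two terms of the maximum. -/
theorem IsEnergyLowerBound.halfLineGap_mul_norm_le [CompleteSpace 𝓗] {H : 𝓗 →ₗ.[ℂ] 𝓗}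
    (hH : IsSelfAdjoint H) {E : ℝ} (hE : IsEnergyLowerBound H E) (z : ℂ) (x : H.domain) :
    halfLineGap E z * ‖(x : 𝓗)‖ ≤ ‖H.subScalar z x‖ := by
  rcases eq_or_ne (x : 𝓗) 0 with h0 | h0
  · rw [h0, norm_zero, mul_zero]; exact norm_nonneg _
  have hpos : 0 < ‖(x : 𝓗)‖ := norm_pos_iff.2 h0
  have him : (⟪(x : 𝓗), H x⟫_ℂ).im = 0 := by
    have h := inner_conj_symm (𝕜 := ℂ) (x : 𝓗) (H x)
    rw [hH.inner_map_left] at h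
    exact Complex.conj_eq_iff_im.1 h
  have hin : ⟪(x : 𝓗), H.subScalar z x⟫_ℂ = ⟪(x : 𝓗), H x⟫_ℂ - z * ((‖(x : 𝓗)‖ ^ 2 : ℝ) : ℂ) := by
    rw [LinearPMap.subScalar_apply, inner_sub_right, inner_smul_right, inner_self_eq_norm_sq_to_K]
    push_cast; rfl
  have hre := congrArg Complex.re hin
  have hi := congrArg Complex.im hin
  rw [Complex.sub_re, Complex.re_mul_ofReal] at hre
  rw [Complex.sub_im, Complex.im_mul_ofReal, him, zero_sub] at hi
  have hn := norm_inner_le_norm (𝕜 := ℂ) (x : 𝓗) (H.subScalar z x)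
  have h1 := Complex.re_le_norm (⟪(x : 𝓗), H.subScalar z x⟫_ℂ)
  have h2 := Complex.abs_im_le_norm (⟪(x : 𝓗), H.subScalar z x⟫_ℂ)
  rw [hi, abs_neg, abs_mul, abs_of_nonneg (sq_nonneg ‖(x : 𝓗)‖)] at h2
  have h3 := hE x
  refine le_of_mul_le_mul_left ?_ hpos
  rcases max_choice (E - z.re) |z.im| with hm | hm <;> rw [halfLineGap, hm] <;> nlinarith

/-- The resolvent `(H - z)⁻¹`, with value `0` if `H - z` is not bijective. -/
noncomputable def LinearPMap.resolvent (H : 𝓗 →ₗ.[ℂ] 𝓗) (z : ℂ) : 𝓗 →ₗ[ℂ] 𝓗 :=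
  open Classical in
  if h : Function.Bijective (H.subScalar z) then
    H.domain.subtype ∘ₗ (LinearEquiv.ofBijective (H.subScalar z) h).symm.toLinearMap
  else 0

theorem LinearPMap.resolvent_subScalar {H : 𝓗 →ₗ.[ℂ] 𝓗} {z : ℂ}
    (h : Function.Bijective (H.subScalar z)) (x : H.domain) :
    H.resolvent z (H.subScalar z x) = x := by
  rw [LinearPMap.resolvent, dif_pos h]
  change ((LinearEquiv.ofBijective (H.subScalar z) h).symm
    ((LinearEquiv.ofBijective (H.subScalar z) h) x) : 𝓗) = x
  rw [LinearEquiv.symm_apply_apply]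

variable [CompleteSpace 𝓗] {H : 𝓗 →ₗ.[ℂ] 𝓗} {E : ℝ}

theorem IsEnergyLowerBound.bijective_subScalar (hH : IsSelfAdjoint H)
    (hE : IsEnergyLowerBound H E) {z : ℂ} (hz : 0 < halfLineGap E z) :
    Function.Bijective (H.subScalar z) := by
  have hb := hE.halfLineGap_mul_norm_le hH z
  refine ⟨(injective_iff_map_eq_zero _).2 fun x hx => ?_, hH.surjective_subScalar hz hb fun x => ?_⟩
  · have h := hb x
    rw [hx, norm_zero] at h
    exact Subtype.ext (norm_le_zero_iff.1 (nonpos_of_mul_nonpos_right h hz))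
  · simpa [halfLineGap] using hE.halfLineGap_mul_norm_le hH (starRingEnd ℂ z) x

/-- Every vector is `(H - z) x` for an `x`, the value of the resolvent on it. -/
theorem IsEnergyLowerBound.exists_subScalar_eq (hH : IsSelfAdjoint H)
    (hE : IsEnergyLowerBound H E) {z : ℂ} (hz : 0 < halfLineGap E z) (y : 𝓗) :
    ∃ x : H.domain, H.subScalar z x = y ∧ H.resolvent z y = x := by
  have hbij := hE.bijective_subScalar hH hz
  obtain ⟨x, rfl⟩ := hbij.2 y
  exact ⟨x, rfl, LinearPMap.resolvent_subScalar hbij x⟩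

theorem IsEnergyLowerBound.norm_resolvent_le (hH : IsSelfAdjoint H)
    (hE : IsEnergyLowerBound H E) {z : ℂ} (hz : 0 < halfLineGap E z) (y : 𝓗) :
    ‖H.resolvent z y‖ ≤ (halfLineGap E z)⁻¹ * ‖y‖ := by
  obtain ⟨x, rfl, hx⟩ := hE.exists_subScalar_eq hH hz y
  rw [hx, inv_mul_eq_div, le_div_iff₀ hz, mul_comm]
  exact hE.halfLineGap_mul_norm_le hH z x

/-- The resolvent identity. -/
theorem IsEnergyLowerBound.resolvent_sub_resolvent (hH : IsSelfAdjoint H)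
    (hE : IsEnergyLowerBound H E) {z w : ℂ} (hz : 0 < halfLineGap E z) (hw : 0 < halfLineGap E w)
    (y : 𝓗) : H.resolvent z y - H.resolvent w y = (z - w) • H.resolvent z (H.resolvent w y) := by
  obtain ⟨x, rfl, hx⟩ := hE.exists_subScalar_eq hH hw y
  have h : H.subScalar w x = H.subScalar z x + (z - w) • (x : 𝓗) := by
    simp only [LinearPMap.subScalar_apply, sub_smul]; abel
  rw [hx]
  conv_lhs => rw [h, map_add, LinearPMap.resolvent_subScalar (hE.bijective_subScalar hH hz),
    map_smul]
  abel

open Filter Topology in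
theorem IsEnergyLowerBound.continuousAt_resolvent (hH : IsSelfAdjoint H)
    (hE : IsEnergyLowerBound H E) {w : ℂ} (hw : 0 < halfLineGap E w) (y : 𝓗) :
    ContinuousAt (fun z => H.resolvent z y) w := by
  have hgap := (continuous_halfLineGap E).continuousAt (x := w)
  rw [ContinuousAt, tendsto_iff_norm_sub_tendsto_zero]
  have hlim : Tendsto (fun z => ‖z - w‖ * ((halfLineGap E z)⁻¹ * ‖H.resolvent w y‖)) (𝓝 w)
      (𝓝 (‖w - w‖ * ((halfLineGap E w)⁻¹ * ‖H.resolvent w y‖))) := by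
    refine Tendsto.mul ?_ ((hgap.tendsto.inv₀ hw.ne').mul_const _)
    exact (continuous_id.sub continuous_const).norm.tendsto w
  rw [sub_self, norm_zero, zero_mul] at hlim
  refine squeeze_zero' (Eventually.of_forall fun _ => norm_nonneg _) ?_ hlim
  filter_upwards [hgap.eventually_const_lt hw] with z hz
  rw [hE.resolvent_sub_resolvent hH hz hw, norm_smul]
  gcongr
  exact hE.norm_resolvent_le hH hz _

-- By the resolvent identity the difference quotient is the resolvent at `z` of a fixed vector, so
-- continuity suffices.
open Filter Topology in
theorem IsEnergyLowerBound.hasDerivAt_resolvent (hH : IsSelfAdjoint H)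
    (hE : IsEnergyLowerBound H E) {w : ℂ} (hw : 0 < halfLineGap E w) (y : 𝓗) :
    HasDerivAt (fun z => H.resolvent z y) (H.resolvent w (H.resolvent w y)) w := by
  rw [hasDerivAt_iff_tendsto_slope]
  refine ((hE.continuousAt_resolvent hH hw (H.resolvent w y)).tendsto.mono_left
    nhdsWithin_le_nhds).congr' ?_
  have hgap := (continuous_halfLineGap E).continuousAt (x := w)
  filter_upwards [nhdsWithin_le_nhds (hgap.eventually_const_lt hw), self_mem_nhdsWithin] with z hz hzw
  rw [slope_def_module, hE.resolvent_sub_resolvent hH hz hw, smul_smul,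
    inv_mul_cancel₀ (sub_ne_zero.2 hzw), one_smul]

/-- Matrix elements of the resolvent of an operator bounded below that vanish on the upper
half-plane vanish off the spectral half-line. -/
theorem IsEnergyLowerBound.inner_resolvent_eq_zero (hH : IsSelfAdjoint H)
    (hE : IsEnergyLowerBound H E) {x y : 𝓗}
    (h : ∀ z : ℂ, 0 < z.im → ⟪x, H.resolvent z y⟫_ℂ = 0) {z : ℂ} (hz : 0 < halfLineGap E z) :
    ⟪x, H.resolvent z y⟫_ℂ = 0 := by
  -- The substitution z = E - w carries the slit plane to the complement of [E, ∞) and swaps the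
  -- half-planes, hence the base point `-I`.
  let F : ℂ → ℂ := fun w => ⟪x, H.resolvent (E - w) y⟫_ℂ
  have hd : DifferentiableOn ℂ F Complex.slitPlane := by
    intro w hw
    have hg : 0 < halfLineGap E (E - w) := halfLineGap_pos_iff.2 (by simpa using hw)
    have h1 := (hE.hasDerivAt_resolvent hH hg y).scomp w ((hasDerivAt_id w).const_sub (E : ℂ))
    exact ((innerSL ℂ x).hasFDerivAt.comp_hasDerivAt w h1).differentiableAt.differentiableWithinAt
  have hpre : IsPreconnected Complex.slitPlane :=
    (Complex.starConvex_one_slitPlane.isPathConnected Complex.one_mem_slitPlane).isConnected.2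
  have hF := (hd.analyticOnNhd Complex.isOpen_slitPlane).eqOn_zero_of_preconnected_of_eventuallyEq_zero
    hpre (z₀ := -Complex.I) (by simp [Complex.mem_slitPlane_iff]) (by
      have : {w : ℂ | w.im < 0} ∈ nhds (-Complex.I) :=
        (isOpen_lt Complex.continuous_im continuous_const).mem_nhds (by simp)
      filter_upwards [this] with w hw
      exact h _ (by simpa using hw))
  have := hF (halfLineGap_pos_iff.1 hz)
  simpa [F] using this

end Resolvent

/-! ### Injectivity of the Laplace transform -/

/-- A continuous function that vanishes at `0` and whose exponentially damped Laplace transforms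
over the negative half-line vanish is zero there. -/
theorem eq_zero_of_integral_Iic_cexp_mul_eq_zero {f : ℝ → ℂ} (hf : Continuous f) {C : ℝ}
    (hC : ∀ t, ‖f t‖ ≤ C) (h0 : f 0 = 0)
    (hint : ∀ p : ℂ, 0 < p.re → ∫ t in Set.Iic (0 : ℝ), Complex.exp (p * t) * f t = 0)
    {t : ℝ} (ht : t ≤ 0) : f t = 0 := by
  -- The weight makes the cut-off function integrable; `f 0 = 0` makes it continuous at the cut, so
  -- Fourier inversion holds pointwise.
  let k : ℝ → ℂ := fun t => Complex.exp t * f t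
  let g : ℝ → ℂ := (Set.Iic (0 : ℝ)).indicator k
  have hk : Continuous k := by fun_prop
  have hg : Continuous g := by
    refine continuous_indicator (fun x hx => ?_) hk.continuousOn
    rw [frontier_Iic, Set.mem_singleton_iff] at hx
    simp [k, hx, h0]
  have hgi : MeasureTheory.Integrable g := by
    rw [MeasureTheory.integrable_indicator_iff measurableSet_Iic]
    refine ((integrableOn_exp_Iic 0).mul_const C).mono' hk.aestronglyMeasurable ?_
    refine Filter.Eventually.of_forall fun x => ?_
    rw [norm_mul, Complex.norm_exp, Complex.ofReal_re]
    gcongr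
    exact hC x
  have hF : FourierTransform.fourier g = 0 := by
    funext ξ
    rw [Real.fourier_real_eq_integral_exp_smul, Pi.zero_apply,
      ← hint (1 - 2 * Real.pi * ξ * Complex.I) (by simp),
      ← MeasureTheory.integral_indicator measurableSet_Iic]
    congr 1
    funext v
    by_cases hv : v ∈ Set.Iic (0 : ℝ)
    · simp only [g, k, Set.indicator_of_mem hv, smul_eq_mul]
      rw [← mul_assoc, ← Complex.exp_add]
      congr 2
      push_cast
      ring
    · simp only [g, Set.indicator_of_notMem hv, smul_zero]
  have hinv := hg.fourierInv_fourier_eq hgi (by rw [hF]; exact MeasureTheory.integrable_zero _ _ _)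
  have hgt : g t = 0 := by
    rw [← hinv, hF, Real.fourierInv_eq]
    simp
  simpa [g, k, Set.indicator_of_mem (show t ∈ Set.Iic (0 : ℝ) from ht)] using hgt

/-! ### Conservation laws and unitarity -/

section Propagator

variable {𝓗 : Type*} [NormedAddCommGroup 𝓗] [InnerProductSpace ℂ 𝓗]

/-- A curve `ψ` solves the Schrödinger equation `iħ dψ/dt = Hψ`. -/
def IsSchrodingerSolution (ħ : ℝ) (H : 𝓗 →ₗ.[ℂ] 𝓗) (ψ : ℝ → 𝓗) : Prop :=
  ∀ t : ℝ, ∃ h : ψ t ∈ H.domain, HasDerivAt ψ (-(Complex.I / (ħ : ℂ)) • H ⟨ψ t, h⟩) t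

variable {ħ : ℝ} {H : 𝓗 →ₗ.[ℂ] 𝓗} {U : ℝ → 𝓗 →L[ℂ] 𝓗} {φ ψ : ℝ → 𝓗}

theorem IsSchrodingerSolution.sub (hφ : IsSchrodingerSolution ħ H φ)
    (hψ : IsSchrodingerSolution ħ H ψ) : IsSchrodingerSolution ħ H (φ - ψ) := fun t => by
  obtain ⟨h1, d1⟩ := hφ t
  obtain ⟨h2, d2⟩ := hψ t
  refine ⟨H.domain.sub_mem h1 h2, (d1.sub d2).congr_deriv ?_⟩
  rw [← smul_sub, ← LinearPMap.map_sub]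
  rfl

theorem IsSchrodingerSolution.comp_sub_const (hψ : IsSchrodingerSolution ħ H ψ) (a : ℝ) :
    IsSchrodingerSolution ħ H (fun t => ψ (t - a)) := fun t => by
  obtain ⟨h, d⟩ := hψ (t - a)
  exact ⟨h, d.comp_sub_const t a⟩

theorem IsPropagator.isSchrodingerSolution (hU : IsPropagator ħ H U) {x : 𝓗} (hx : x ∈ H.domain) :
    IsSchrodingerSolution ħ H (fun t => U t x) := hU.schrodinger x hx

variable [CompleteSpace 𝓗]

/-- The inner product of two solutions is conserved. -/
theorem IsSchrodingerSolution.inner_eq (hH : IsSelfAdjoint H) (hφ : IsSchrodingerSolution ħ H φ)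
    (hψ : IsSchrodingerSolution ħ H ψ) (s t : ℝ) : ⟪φ s, ψ s⟫_ℂ = ⟪φ t, ψ t⟫_ℂ := by
  have key : ∀ s : ℝ, HasDerivAt (fun s : ℝ => ⟪φ s, ψ s⟫_ℂ) 0 s := by
    intro s
    obtain ⟨hu, du⟩ := hφ s
    obtain ⟨hv, dv⟩ := hψ s
    refine (du.inner ℂ dv).congr_deriv ?_
    have hs := hH.inner_map_left ⟨φ s, hu⟩ ⟨ψ s, hv⟩
    simp only at hs
    rw [inner_smul_left, inner_smul_right, hs]
    simp
    ring
  exact is_const_of_deriv_eq_zero (fun s => (key s).differentiableAt) (fun s => (key s).deriv) s t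

/-- Solutions are determined by their initial value. -/
theorem IsSchrodingerSolution.unique (hH : IsSelfAdjoint H) (hφ : IsSchrodingerSolution ħ H φ)
    (hψ : IsSchrodingerSolution ħ H ψ) (h0 : φ 0 = ψ 0) : φ = ψ := by
  funext t
  have h := (hφ.sub hψ).inner_eq hH (hφ.sub hψ) t 0
  rw [Pi.sub_apply, Pi.sub_apply, h0, sub_self, inner_zero_left] at h
  exact sub_eq_zero.1 (inner_self_eq_zero.1 h)

theorem IsPropagator.norm_apply (hH : IsSelfAdjoint H) (hU : IsPropagator ħ H U) (t : ℝ) (x : 𝓗) :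
    ‖U t x‖ = ‖x‖ := by
  refine congrFun (Continuous.ext_on hH.dense_domain (U t).continuous.norm continuous_norm
    fun y hy => ?_) x
  have hs := hU.isSchrodingerSolution hy
  have h := hs.inner_eq hH hs t 0
  simp only [hU.map_zero, one_apply_eq_self] at h
  simp only [@norm_eq_sqrt_re_inner ℂ, h]

/-- The adjoint of the propagator is the reversed evolution. -/
theorem IsPropagator.inner_apply_left (hH : IsSelfAdjoint H) (hU : IsPropagator ħ H U) (t : ℝ)
    (x y : 𝓗) : ⟪U t x, y⟫_ℂ = ⟪x, U (-t) y⟫_ℂ := by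
  have hdom : ∀ x ∈ H.domain, ∀ y ∈ H.domain, ⟪U t x, y⟫_ℂ = ⟪x, U (-t) y⟫_ℂ := by
    intro x hx y hy
    have h := (hU.isSchrodingerSolution hx).inner_eq hH
      ((hU.isSchrodingerSolution hy).comp_sub_const t) t 0
    simpa [hU.map_zero] using h
  refine congrFun (Continuous.ext_on hH.dense_domain (f := fun x => ⟪U t x, y⟫_ℂ)
    (g := fun x => ⟪x, U (-t) y⟫_ℂ) (by fun_prop) (by fun_prop) fun x hx => ?_) x
  exact congrFun (Continuous.ext_on hH.dense_domain (f := fun y => ⟪U t x, y⟫_ℂ)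
    (g := fun y => ⟪x, U (-t) y⟫_ℂ) (by fun_prop) (by fun_prop) fun y hy => hdom x hx y hy) y

/-- Orbits of domain vectors are differentiable, and isometry makes approximation by them uniform in
time. -/
theorem IsPropagator.continuous_inner_apply (hH : IsSelfAdjoint H) (hU : IsPropagator ħ H U)
    (x y : 𝓗) : Continuous fun t => ⟪x, U t y⟫_ℂ := by
  refine continuous_of_uniform_approx_of_continuous fun u hu => ?_
  obtain ⟨ε, hε, hεu⟩ := Metric.mem_uniformity_dist.1 hu
  have hδ : 0 < ε / (‖x‖ + 1) := by positivity
  obtain ⟨v, hv, hyv⟩ := hH.dense_domain.exists_dist_lt y hδ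
  refine ⟨fun t => ⟪x, U t v⟫_ℂ, ?_, fun t => hεu ?_⟩
  · have hc : Continuous fun t => U t v :=
      continuous_iff_continuousAt.2 fun t => (hU.schrodinger v hv t).choose_spec.continuousAt
    fun_prop
  · rw [dist_eq_norm, ← inner_sub_right, ← map_sub]
    calc ‖⟪x, U t (y - v)⟫_ℂ‖ ≤ ‖x‖ * ‖y - v‖ := by
          rw [← hU.norm_apply hH t (y - v)]
          exact norm_inner_le_norm _ _
      _ ≤ (‖x‖ + 1) * ‖y - v‖ := by gcongr; linarith
      _ < ε := by
          rw [dist_eq_norm, lt_div_iff₀ (by positivity)] at hyv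
          linarith

/-! ### Laplace transforms of the evolution -/

variable {E : ℝ}

/-- The resolvent commutes with `H` on the domain, so it maps solutions to solutions; uniqueness
identifies the two sides. -/
theorem IsPropagator.resolvent_apply (hH : IsSelfAdjoint H) (hE : IsEnergyLowerBound H E)
    (hU : IsPropagator ħ H U) {z : ℂ} (hz : 0 < halfLineGap E z) (t : ℝ) (y : 𝓗) :
    H.resolvent z (U t y) = U t (H.resolvent z y) := by
  let R : 𝓗 →L[ℂ] 𝓗 := (H.resolvent z).mkContinuous _ (hE.norm_resolvent_le hH hz)
  change (R ∘L U t) y = (U t ∘L R) y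
  refine congrFun (Continuous.ext_on hH.dense_domain (R ∘L U t).continuous
    (U t ∘L R).continuous fun x hx => ?_) y
  have hRdom : ∀ y, R y ∈ H.domain := fun y => by
    obtain ⟨x, -, hx⟩ := hE.exists_subScalar_eq hH hz y
    exact hx ▸ x.2
  have hsol : IsSchrodingerSolution ħ H (fun s => R (U s x)) := fun s => by
    obtain ⟨h, d⟩ := hU.schrodinger x hx s
    refine ⟨hRdom _, ((R.hasFDerivAt.restrictScalars ℝ).comp_hasDerivAt s d).congr_deriv ?_⟩
    change R _ = _
    rw [map_smul]
    congr 1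
    obtain ⟨v, hv, hRv⟩ := hE.exists_subScalar_eq hH hz (U s x)
    have hv' : (⟨R (U s x), hRdom _⟩ : H.domain) = v := Subtype.ext hRv
    have hHv : H v = U s x + z • (v : 𝓗) := by
      rw [← hv, LinearPMap.subScalar_apply]; abel
    have hHU : H ⟨U s x, h⟩ = H.subScalar z ⟨U s x, h⟩ + z • U s x := by
      rw [LinearPMap.subScalar_apply]; abel
    rw [hv', hHv, hHU, map_add, map_smul]
    have h1 : R (H.subScalar z ⟨U s x, h⟩) = U s x :=
      LinearPMap.resolvent_subScalar (hE.bijective_subScalar hH hz) ⟨U s x, h⟩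
    have h2 : R (U s x) = v := hRv
    rw [h1, h2]
  exact congrFun (hsol.unique hH (hU.isSchrodingerSolution (hRdom x)) (by simp [hU.map_zero])) t

/-- The damped evolution of a resolvent vector is a primitive of the damped evolution. -/
theorem IsPropagator.hasDerivAt_exp_mul_inner (hH : IsSelfAdjoint H) (hE : IsEnergyLowerBound H E)
    (hU : IsPropagator ħ H U) {z : ℂ} (hz : 0 < halfLineGap E z) (x y : 𝓗) (t : ℝ) :
    HasDerivAt (fun t : ℝ => Complex.exp (Complex.I / ħ * z * t) * ⟪x, U t (H.resolvent z y)⟫_ℂ)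
      (-(Complex.I / ħ) * (Complex.exp (Complex.I / ħ * z * t) * ⟪x, U t y⟫_ℂ)) t := by
  obtain ⟨v, hv, hRv⟩ := hE.exists_subScalar_eq hH hz y
  obtain ⟨h, d⟩ := hU.schrodinger v v.2 t
  have hHU : H ⟨U t v, h⟩ = U t y + z • U t v := by
    obtain ⟨w, hw, hRw⟩ := hE.exists_subScalar_eq hH hz (U t y)
    have hwv : w = ⟨U t v, h⟩ := Subtype.ext (by
      rw [← hRw, hU.resolvent_apply hH hE hz, hRv])
    rw [← hw, hwv, LinearPMap.subScalar_apply]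
    abel
  have d1 : HasDerivAt (fun t : ℝ => Complex.exp (Complex.I / ħ * z * t))
      (Complex.exp (Complex.I / ħ * z * t) * (Complex.I / ħ * z)) t := by
    simpa using (((hasDerivAt_id t).ofReal_comp.const_mul (Complex.I / ħ * z)).cexp)
  have d2 := (hasDerivAt_const t x).inner ℂ d
  rw [hRv]
  refine (d1.mul d2).congr_deriv ?_
  rw [hHU, inner_zero_left, add_zero, inner_smul_right, inner_add_right, inner_smul_right]
  ring

theorem norm_cexp_I_div_mul (ħ : ℝ) (z : ℂ) (t : ℝ) :
    ‖Complex.exp (Complex.I / ħ * z * t)‖ = Real.exp (-(z.im / ħ) * t) := by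
  rw [Complex.norm_exp]
  congr 1
  rw [Complex.re_mul_ofReal, div_mul_eq_mul_div, Complex.div_ofReal_re, Complex.I_mul_re]
  ring

open Filter Topology in
theorem IsPropagator.tendsto_exp_mul_inner (hH : IsSelfAdjoint H) (hU : IsPropagator ħ H U)
    {z : ℂ} (x y : 𝓗) {l : Filter ℝ} (hl : Tendsto (fun t => -(z.im / ħ) * t) l atBot) :
    Tendsto (fun t : ℝ => Complex.exp (Complex.I / ħ * z * t) * ⟪x, U t y⟫_ℂ) l (𝓝 0) := by
  have h := (Real.tendsto_exp_atBot.comp hl).mul_const (‖x‖ * ‖y‖)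
  rw [zero_mul] at h
  refine squeeze_zero_norm (fun t => ?_) h
  rw [norm_mul, norm_cexp_I_div_mul, ← hU.norm_apply hH t y]
  exact mul_le_mul_of_nonneg_left (norm_inner_le_norm _ _) (Real.exp_nonneg _)

open Filter Topology in
/-- A transition amplitude that vanishes at all later times has vanishing resolvent matrix elements
in the upper half-plane. -/
theorem IsPropagator.inner_resolvent_eq_zero_of_forward (hħ : 0 < ħ) (hH : IsSelfAdjoint H)
    (hE : IsEnergyLowerBound H E) (hU : IsPropagator ħ H U) {x y : 𝓗}
    (h : ∀ t, 0 ≤ t → ⟪x, U t y⟫_ℂ = 0) {z : ℂ} (hz : 0 < z.im) :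
    ⟪x, H.resolvent z y⟫_ℂ = 0 := by
  have hg : 0 < halfLineGap E z := lt_max_of_lt_right (abs_pos.2 hz.ne')
  have hd := hU.hasDerivAt_exp_mul_inner hH hE hg x y
  have hlim := hU.tendsto_exp_mul_inner hH (z := z) x (H.resolvent z y) (l := atTop)
    (tendsto_id.const_mul_atTop_of_neg (neg_lt_zero.2 (div_pos hz hħ)))
  -- The vanishing amplitude makes the primitive constant for t ≥ 0, while it decays at infinity.
  have hconst : ∀ t : ℝ, 0 ≤ t → Complex.exp (Complex.I / ħ * z * t) * ⟪x, U t (H.resolvent z y)⟫_ℂ =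
      ⟪x, H.resolvent z y⟫_ℂ := fun t ht => by
    have := constant_of_has_deriv_right_zero (a := 0) (b := t)
      (fun s _ => (hd s).continuousAt.continuousWithinAt)
      (fun s hs => by
        have := (hd s).hasDerivWithinAt (s := Set.Ici s)
        rwa [h s hs.1, mul_zero, mul_zero] at this) t ⟨ht, le_rfl⟩
    simpa [hU.map_zero] using this
  refine tendsto_nhds_unique (tendsto_const_nhds.congr' ?_) hlim
  filter_upwards [eventually_ge_atTop 0] with t ht
  exact (hconst t ht).symm

open Filter Topology in
/-- If the resolvent matrix elements vanish in the lower half-plane, so does the transition amplitude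
at all earlier times. -/
theorem IsPropagator.inner_apply_eq_zero_of_resolvent (hħ : 0 < ħ) (hH : IsSelfAdjoint H)
    (hE : IsEnergyLowerBound H E) (hU : IsPropagator ħ H U) {x y : 𝓗} (hxy : ⟪x, y⟫_ℂ = 0)
    (h : ∀ z : ℂ, z.im < 0 → ⟪x, H.resolvent z y⟫_ℂ = 0) {t : ℝ} (ht : t ≤ 0) :
    ⟪x, U t y⟫_ℂ = 0 := by
  have hħ' : (ħ : ℂ) ≠ 0 := Complex.ofReal_ne_zero.2 hħ.ne'
  have hcont := hU.continuous_inner_apply hH x y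
  have hbd : ∀ t, ‖⟪x, U t y⟫_ℂ‖ ≤ ‖x‖ * ‖y‖ := fun t => by
    rw [← hU.norm_apply hH t y]; exact norm_inner_le_norm _ _
  refine eq_zero_of_integral_Iic_cexp_mul_eq_zero hcont hbd (by simp [hU.map_zero, hxy])
    (fun p hp => ?_) ht
  obtain ⟨z, rfl⟩ : ∃ z : ℂ, p = Complex.I / ħ * z :=
    ⟨-Complex.I * ħ * p, by field_simp; rw [Complex.I_sq]; ring⟩
  have hz : z.im < 0 := by
    rw [div_mul_eq_mul_div, Complex.div_ofReal_re, Complex.I_mul_re] at hp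
    have := (div_pos_iff_of_pos_right hħ).1 hp
    linarith
  have hg : 0 < halfLineGap E z := lt_max_of_lt_right (abs_pos.2 hz.ne)
  have hd := hU.hasDerivAt_exp_mul_inner hH hE hg x y
  have hzħ : 0 < -(z.im / ħ) := neg_pos.2 (div_neg_of_neg_of_pos hz hħ)
  have hlim := hU.tendsto_exp_mul_inner hH (z := z) x (H.resolvent z y) (l := atBot)
    (tendsto_id.const_mul_atBot hzħ)
  have hi : MeasureTheory.IntegrableOn
      (fun t : ℝ => Complex.exp (Complex.I / ħ * z * t) * ⟪x, U t y⟫_ℂ) (Set.Iic 0) := by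
    refine ((integrableOn_exp_mul_Iic hzħ 0).mul_const (‖x‖ * ‖y‖)).mono'
      (by fun_prop) (Eventually.of_forall fun s => ?_)
    rw [norm_mul, norm_cexp_I_div_mul]
    exact mul_le_mul_of_nonneg_left (hbd s) (Real.exp_nonneg _)
  -- The primitive tends to `0` at `-∞`, and its value at time `0` is the resolvent matrix element.
  have hint := MeasureTheory.integral_Iic_of_hasDerivAt_of_tendsto
    (hd 0).continuousAt.continuousWithinAt (fun s _ => hd s) (hi.const_mul _) hlim
  rw [MeasureTheory.integral_const_mul] at hint
  simp only [hU.map_zero, one_apply_eq_self, h z hz, mul_zero, sub_zero] at hint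
  exact (mul_eq_zero.1 hint).resolve_left (neg_ne_zero.2 (div_ne_zero Complex.I_ne_zero hħ'))

/-- For a Hamiltonian bounded below, a transition amplitude that vanishes at all later times
vanishes at all times. -/
theorem IsPropagator.inner_apply_eq_zero_of_forward (hħ : 0 < ħ) (hH : IsSelfAdjoint H)
    (hE : IsEnergyLowerBound H E) (hU : IsPropagator ħ H U) {x y : 𝓗}
    (h : ∀ t, 0 ≤ t → ⟪x, U t y⟫_ℂ = 0) (t : ℝ) : ⟪x, U t y⟫_ℂ = 0 := by
  rcases le_total 0 t with ht | ht
  · exact h t ht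
  · refine hU.inner_apply_eq_zero_of_resolvent hħ hH hE (by simpa [hU.map_zero] using h 0 le_rfl)
      (fun z hz => ?_) ht
    exact hE.inner_resolvent_eq_zero hH
      (fun w hw => hU.inner_resolvent_eq_zero_of_forward hħ hH hE h hw)
      (lt_max_of_lt_right (abs_pos.2 hz.ne))

end Propagator

theorem theorem2 {𝓗 : Type*} [NormedAddCommGroup 𝓗] [InnerProductSpace ℂ 𝓗] [CompleteSpace 𝓗]
    (ħ : ℝ) (hħ : 0 < ħ) (H : 𝓗 →ₗ.[ℂ] 𝓗) (hH : IsSelfAdjoint H)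
    (s₁ s₂ : 𝓗) (hs₁ : ‖s₁‖ = 1) (hs₂ : ‖s₂‖ = 1) (t₁ t₂ : ℝ) (ht : t₁ < t₂)
    (hamp : ⟪s₂, timeEvolution ħ H (t₂ - t₁) s₁⟫_ℂ ≠ 0)
    (hdist : ⟪s₁, s₂⟫_ℂ = 0)
    (hret : ∀ t : ℝ, t₂ < t → ‖⟪s₁, timeEvolution ħ H (t - t₂) s₂⟫_ℂ‖ ^ 2 = 0) :
    ¬ IsBoundedBelow H ∧ ¬ HasGroundState H := by
  have hU : IsPropagator ħ H (timeEvolution ħ H) := by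
    by_cases hex : ∃ U : ℝ → 𝓗 →L[ℂ] 𝓗, IsPropagator ħ H U
    · rw [timeEvolution, dif_pos hex]
      exact hex.choose_spec
    -- The default evolution `0` contradicts the nonzero amplitude, so a propagator exists.
    · rw [timeEvolution, dif_neg hex] at hamp
      simp at hamp
  have hnot : ¬ IsBoundedBelow H := by
    rintro ⟨E, hE⟩
    have hfwd : ∀ t, 0 ≤ t → ⟪s₁, timeEvolution ħ H t s₂⟫_ℂ = 0 := fun t h0 => by
      -- `hret` covers only strictly later times; time `0` is the orthogonality of the states.
      rcases h0.eq_or_lt with rfl | h0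
      · simpa [hU.map_zero] using hdist
      · have h := hret (t + t₂) (by linarith)
        rw [add_sub_cancel_right] at h
        exact norm_eq_zero.1 (pow_eq_zero_iff two_ne_zero |>.1 h)
    apply hamp
    rw [← inner_conj_symm, hU.inner_apply_left hH,
      hU.inner_apply_eq_zero_of_forward hħ hH hE hfwd, map_zero]
  exact ⟨hnot, fun ⟨E, _, _, _, hE⟩ => hnot ⟨E, hE⟩⟩
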